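/- Let $f:\mathbb R^n\times\mathbb R^m\to\mathbb R$ be a $C^\infty$ function and let $(x^*,y^*)$ be a local Nash equilibrium of $\min_x\max_y f(x,y)$, i.e. there are neighborhoods $U$ of $x^*$ and $V$ of $y^*$ with $f(x,y^*)\ge f(x^*,y^*)\ge f(x^*,y)$ for all $x\in U$, $y\in V$. With all second derivatives evaluated at $(x^*,y^*)$, put $$\mathcal S=\begin{bmatrix}-\nabla_x^2 f&0\\0&\nabla_y^2 f\end{bmatrix},\qquad \mathcal A=\begin{bmatrix}0&-\nabla_{xy}f\\ \nabla_{yx}f&0\end{bmatrix},\qquad \mathcal J=\mathcal S+\mathcal A,$$ and let $\mathrm{Sp}(\mathcal J)\subset\mathbb C$ be the set of eigenvalues of $\mathcal J$. Assume that 1. $|\operatorname{Im}\lambda|>|\operatorname{Re}\lambda|$ for all $\lambda\in\mathrm{Sp}(\mathcal J)$; 2. no eigenvector $v\in\mathbb C^{n+m}\setminus\{0\}$ of $\mathcal A$ satisfies $\mathcal S v=0$. Let $\beta\in(-1,1)$ and let $h>0$ satisfy $$h<\min_{\lambda\in\mathrm{Sp}(\mathcal J)}\frac{2(1-\beta)^2}{1+\beta}\cdot\frac{|\operatorname{Re}\lambda|}{(\operatorname{Im}\lambda)^2-(\operatorname{Re}\lambda)^2}.$$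 Let $$\mathcal F(x,y)=\frac1{1-\beta}f(x,y)+\frac{h(1+\beta)}{4(1-\beta)^3}\left(\|\nabla_x f(x,y)\|^2-\|\nabla_y f(x,y)\|^2\right).$$ Then the system (Continuous Sim-HB) $$\dot x=-\nabla_x\mathcal F(x,y),\qquad \dot y=\nabla_y\mathcal F(x,y)$$ converges locally to $z^*=(x^*,y^*)$ at an exponential rate: there are $\delta,C,c>0$ such that for every $z_0\in\mathbb R^{n+m}$ with $\|z_0-z^*\|\le\delta$ the system has a solution on $[0,\infty)$ with $z(0)=z_0$, and every such solution satisfies $\|z(t)-z^*\|\le Ce^{-ct}\|z_0-z^*\|$ for all $t\ge0$. -/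

import Mathlib

open scoped ContDiff Topology

noncomputable section

namespace MinMaxGame

/-- The space `ℝ^k` with its Euclidean structure. -/
abbrev Euc (k : ℕ) : Type := EuclideanSpace ℝ (Fin k)

/-- `(xs, ys)` is a local Nash equilibrium of `min_x max_y f(x, y)`. -/
def IsLocalNash {n m : ℕ} (f : Euc n × Euc m → ℝ) (xs : Euc n) (ys : Euc m) : Prop :=
  ∃ U ∈ 𝓝 xs, ∃ V ∈ 𝓝 ys,
    (∀ x ∈ U, f (xs, ys) ≤ f (x, ys)) ∧ (∀ y ∈ V, f (xs, y) ≤ f (xs, ys))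

/-- The partial gradient `∇ₓ f`. -/
def gradX {n m : ℕ} (f : Euc n × Euc m → ℝ) (p : Euc n × Euc m) : Euc n :=
  gradient (fun x => f (x, p.2)) p.1

/-- The partial gradient `∇_y f`. -/
def gradY {n m : ℕ} (f : Euc n × Euc m → ℝ) (p : Euc n × Euc m) : Euc m :=
  gradient (fun y => f (p.1, y)) p.2

/-- The Jacobian matrix `(∂gᵢ/∂xⱼ)(x)` of a map between Euclidean spaces. -/
def jacobianMatrix {k l : ℕ} (g : Euc k → Euc l) (x : Euc k) : Matrix (Fin l) (Fin k) ℝ :=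
  Matrix.of fun i j => (fderiv ℝ g x (EuclideanSpace.single j 1)) i

/-- `∇²ₓ f`, with entries `∂²f/∂xᵢ∂xⱼ`. -/
def hessXX {n m : ℕ} (f : Euc n × Euc m → ℝ) (p : Euc n × Euc m) : Matrix (Fin n) (Fin n) ℝ :=
  jacobianMatrix (fun x => gradX f (x, p.2)) p.1

/-- `∇_{xy} f`, with entries `∂²f/∂xᵢ∂yⱼ`. -/
def hessXY {n m : ℕ} (f : Euc n × Euc m → ℝ) (p : Euc n × Euc m) : Matrix (Fin n) (Fin m) ℝ :=
  jacobianMatrix (fun y => gradX f (p.1, y)) p.2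

/-- `∇_{yx} f`, with entries `∂²f/∂yᵢ∂xⱼ`. -/
def hessYX {n m : ℕ} (f : Euc n × Euc m → ℝ) (p : Euc n × Euc m) : Matrix (Fin m) (Fin n) ℝ :=
  jacobianMatrix (fun x => gradY f (x, p.2)) p.1

/-- `∇²_y f`, with entries `∂²f/∂yᵢ∂yⱼ`. -/
def hessYY {n m : ℕ} (f : Euc n × Euc m → ℝ) (p : Euc n × Euc m) : Matrix (Fin m) (Fin m) ℝ :=
  jacobianMatrix (fun y => gradY f (p.1, y)) p.2

/-- The Jacobian `𝒥` of the gradient descent-ascent flow `x' = -∇ₓ f`, `y' = ∇_y f`. -/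
def gdaJacobian {n m : ℕ} (f : Euc n × Euc m → ℝ) (p : Euc n × Euc m) :
    Matrix (Fin n ⊕ Fin m) (Fin n ⊕ Fin m) ℝ :=
  Matrix.fromBlocks (-hessXX f p) (-hessXY f p) (hessYX f p) (hessYY f p)

/-- The potential part `𝒮` of the Jacobian. -/
def potentialPart {n m : ℕ} (f : Euc n × Euc m → ℝ) (p : Euc n × Euc m) :
    Matrix (Fin n ⊕ Fin m) (Fin n ⊕ Fin m) ℝ :=
  Matrix.fromBlocks (-hessXX f p) 0 0 (hessYY f p)

/-- The Hamiltonian part `𝒜` of the Jacobian. -/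
def hamiltonianPart {n m : ℕ} (f : Euc n × Euc m → ℝ) (p : Euc n × Euc m) :
    Matrix (Fin n ⊕ Fin m) (Fin n ⊕ Fin m) ℝ :=
  Matrix.fromBlocks 0 (-hessXY f p) (hessYX f p) 0

/-- A real matrix regarded as a complex one. -/
def toComplex {ι : Type} (M : Matrix ι ι ℝ) : Matrix ι ι ℂ :=
  M.map Complex.ofReal

/-- `Sp(M)`: the set of complex eigenvalues of a real square matrix. -/
def Sp {ι : Type} [Fintype ι] [DecidableEq ι] (M : Matrix ι ι ℝ) : Set ℂ :=
  spectrum ℂ (toComplex M)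

/-- Dominant interaction: `|Im μ| > |Re μ|` for every eigenvalue `μ` of `𝒥`. -/
def DominantInteraction {n m : ℕ} (f : Euc n × Euc m → ℝ) (p : Euc n × Euc m) : Prop :=
  ∀ μ ∈ Sp (gdaJacobian f p), |μ.re| < |μ.im|

/-- `EigVec(𝒜) ∩ Ker(𝒮) = {0}`: no complex eigenvector of `𝒜` is annihilated by `𝒮`. -/
def EigVecKerTrivial {n m : ℕ} (f : Euc n × Euc m → ℝ) (p : Euc n × Euc m) : Prop :=
  ∀ (μ : ℂ) (v : Fin n ⊕ Fin m → ℂ),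
    (toComplex (hamiltonianPart f p)).mulVec v = μ • v →
    (toComplex (potentialPart f p)).mulVec v = 0 → v = 0

/-- The modified loss `ℱ` with momentum parameter `β` and step size `h`. -/
def modifiedLoss {n m : ℕ} (f : Euc n × Euc m → ℝ) (β h : ℝ) (p : Euc n × Euc m) : ℝ :=
  1 / (1 - β) * f p
    + h * (1 + β) / (4 * (1 - β) ^ 3) * (‖gradX f p‖ ^ 2 - ‖gradY f p‖ ^ 2)

/-- The vector field of Continuous Sim-HB: `x' = -∇ₓ ℱ(x, y)`, `y' = ∇_y ℱ(x, y)`. -/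
def simHBField {n m : ℕ} (f : Euc n × Euc m → ℝ) (β h : ℝ) (p : Euc n × Euc m) :
    Euc n × Euc m :=
  (-gradX (modifiedLoss f β h) p, gradY (modifiedLoss f β h) p)

/-- `z` solves `z'(t) = g (z t)` on `[0, ∞)` (one-sided derivative at `0`). -/
def IsSolution {E : Type} [NormedAddCommGroup E] [NormedSpace ℝ E] (g : E → E) (z : ℝ → E) :
    Prop :=
  ∀ t ∈ Set.Ici (0 : ℝ), HasDerivWithinAt z (g (z t)) (Set.Ici 0) t

/-- Local convergence of `z' = g z` to `zs`, at an exponential rate: from every initial point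
close to `zs` a solution exists for all times `t ≥ 0`, and every such solution satisfies
`‖z t - zs‖ ≤ C e^{-ct} ‖z 0 - zs‖`.  The notion does not change if the norm is replaced by
an equivalent one. -/
def LocallyConverges {E : Type} [NormedAddCommGroup E] [NormedSpace ℝ E] (g : E → E) (zs : E) :
    Prop :=
  ∃ δ > (0 : ℝ), ∃ C > (0 : ℝ), ∃ c > (0 : ℝ), ∀ z₀ : E, ‖z₀ - zs‖ ≤ δ →
    (∃ z : ℝ → E, z 0 = z₀ ∧ IsSolution g z) ∧
    ∀ z : ℝ → E, z 0 = z₀ → IsSolution g z →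
      ∀ t : ℝ, 0 ≤ t → ‖z t - zs‖ ≤ C * Real.exp (-c * t) * ‖z₀ - zs‖

end MinMaxGame

end

/-!
Gradient descent-ascent is the gradient flow of `f` for the indefinite inner product
`⟪y, y'⟫ - ⟪x, x'⟫`, and `ℱ` adds to a multiple of `f` a multiple of the indefinite square of its
own gradient field `G = (-∇ₓ f, ∇_y f)`. Since `DG` is symmetric for the indefinite product, the
Continuous Sim-HB field is `a G - b DG · G` with `a = 1 / (1 - β)` and
`b = h (1 + β) / (2 (1 - β)³)`. At a zero of `G` the second derivative of `G` drops out of the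
linearization, which is therefore `a 𝒥 - b 𝒥²`. Its eigenvalues `a μ - b μ²` have real part
`a Re μ + b ((Im μ)² - (Re μ)²)`; the second-order conditions at a Nash equilibrium give `Re μ ≤ 0`,
and the bound on `h` then makes this real part negative. For a matrix `K` with spectrum in the left
half-plane, the powers of `1 + ε K` tend to `0` for small `ε > 0`, so a truncated Stein series is a
quadratic Lyapunov function of `x' = K x`, and it remains one for the nonlinear system near the
equilibrium.
-/

noncomputable section

namespace MinMaxGame

section LyapunovFunctions

lemma le_mul_exp_of_deriv_right_lt {W W' : ℝ → ℝ} {T c w : ℝ} (hc : 0 ≤ c)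
    (hcont : ContinuousOn W (Set.Icc 0 T))
    (hderiv : ∀ s ∈ Set.Ico 0 T, HasDerivWithinAt W (W' s) (Set.Ici s) s)
    (h0 : 0 ≤ W 0) (hw : W 0 < w)
    (hdec : ∀ s ∈ Set.Ico 0 T, 0 < W s → W s < w → W' s < -c * W s)
    {t : ℝ} (ht : t ∈ Set.Icc 0 T) : W t ≤ W 0 * Real.exp (-c * t) := by
  -- The fence must be positive for `hdec` to apply, so it is raised by `ε` and `ε → 0`.
  have fence : ∀ ε ∈ Set.Ioo 0 (w - W 0), W t ≤ (W 0 + ε) * Real.exp (-c * t) := by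
    intro ε hε
    have hpos : 0 < W 0 + ε := add_pos_of_nonneg_of_pos h0 hε.1
    refine image_le_of_deriv_right_lt_deriv_boundary
      (B := fun s => (W 0 + ε) * Real.exp (-c * s))
      (B' := fun s => (W 0 + ε) * (Real.exp (-c * s) * -c)) hcont hderiv ?_ ?_ ?_ ht
    · simp [hε.1.le]
    · intro s
      simpa using ((hasDerivAt_id s).const_mul (-c)).exp.const_mul (W 0 + ε)
    · intro s hs hWs
      have hexp : Real.exp (-c * s) ≤ 1 := by
        rw [Real.exp_le_one_iff, neg_mul, neg_nonpos]
        exact mul_nonneg hc hs.1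
      have hWpos : 0 < W s := hWs ▸ mul_pos hpos (Real.exp_pos _)
      have hWw : W s < w :=
        hWs ▸ (mul_le_of_le_one_right hpos.le hexp).trans_lt (lt_sub_iff_add_lt'.1 hε.2)
      exact (hdec s hs hWpos hWw).trans_eq (by rw [hWs]; ring)
  have hlim : Filter.Tendsto (fun ε : ℝ => (W 0 + ε) * Real.exp (-c * t)) (𝓝[>] 0)
      (𝓝 ((W 0 + 0) * Real.exp (-c * t))) :=
    (Continuous.tendsto (by fun_prop) 0).mono_left nhdsWithin_le_nhds
  rw [add_zero] at hlim
  exact ge_of_tendsto hlim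
    (Filter.mem_of_superset (Ioo_mem_nhdsGT (sub_pos.2 hw)) fence)

variable {E : Type*} [NormedAddCommGroup E] [NormedSpace ℝ E]

/-- `B` is a quadratic Lyapunov function of the linear system `x' = A x`, given by a symmetric
bilinear form. -/
structure IsLyapunovForm (A : E →L[ℝ] E) (B : E →L[ℝ] E →L[ℝ] ℝ) : Prop where
  symm : ∀ x y, B x y = B y x
  coercive : IsCoercive B
  decreasing : ∃ b > 0, ∀ x, B x (A x) ≤ -b * ‖x‖ ^ 2

variable {g : E → E} {zs : E} {B : E →L[ℝ] E →L[ℝ] ℝ}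

lemma IsLyapunovForm.conj {E' : Type*} [NormedAddCommGroup E'] [NormedSpace ℝ E']
    {A : E →L[ℝ] E} {A' : E' →L[ℝ] E'} (hB : IsLyapunovForm A B) (e : E' ≃L[ℝ] E)
    (he : ∀ x, e (A' x) = A (e x)) :
    IsLyapunovForm A' (B.bilinearComp (e : E' →L[ℝ] E) (e : E' →L[ℝ] E)) := by
  obtain ⟨a, ha, hlow⟩ := hB.coercive
  obtain ⟨b, hb, hdec⟩ := hB.decreasing
  obtain ⟨κ, hκ, hnorm⟩ : ∃ κ > 0, ∀ x, κ * ‖x‖ ^ 2 ≤ ‖e x‖ ^ 2 := by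
    refine ⟨(‖(e.symm : E →L[ℝ] E')‖ + 1)⁻¹ ^ 2, by positivity, fun x => ?_⟩
    rw [← mul_pow]
    gcongr
    rw [inv_mul_le_iff₀ (by positivity)]
    calc ‖x‖ = ‖(e.symm : E →L[ℝ] E') (e x)‖ := by simp
      _ ≤ (‖(e.symm : E →L[ℝ] E')‖ + 1) * ‖e x‖ :=
        (ContinuousLinearMap.le_opNorm _ _).trans (by gcongr; simp)
  refine ⟨fun x y => hB.symm _ _, ⟨a * κ, by positivity, fun x => ?_⟩,
    b * κ, by positivity, fun x => ?_⟩
  · calc a * κ * ‖x‖ * ‖x‖ = a * (κ * ‖x‖ ^ 2) := by ring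
      _ ≤ a * ‖e x‖ ^ 2 := by gcongr; exact hnorm x
      _ = a * ‖e x‖ * ‖e x‖ := by ring
      _ ≤ B (e x) (e x) := hlow (e x)
  · calc B (e x) (e (A' x)) ≤ -b * ‖e x‖ ^ 2 := he x ▸ hdec (e x)
      _ ≤ -b * (κ * ‖x‖ ^ 2) := mul_le_mul_of_nonpos_left (hnorm x) (by linarith)
      _ = -(b * κ) * ‖x‖ ^ 2 := by ring

lemma exists_sublevel_subset (hcoer : IsCoercive B) {U : Set E} (hU : U ∈ 𝓝 zs) :
    ∃ w > 0, {x | B (x - zs) (x - zs) < w} ⊆ U := by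
  obtain ⟨a, ha, hlow⟩ := hcoer
  obtain ⟨r, hr, hrU⟩ := Metric.mem_nhds_iff.1 hU
  refine ⟨a * r ^ 2, by positivity, fun x hx => hrU ?_⟩
  have hsq : a * ‖x - zs‖ ^ 2 < a * r ^ 2 := by
    rw [sq, ← mul_assoc]
    exact (hlow _).trans_lt hx
  rw [mem_ball_iff_norm]
  exact lt_of_pow_lt_pow_left₀ 2 hr.le (lt_of_mul_lt_mul_left hsq ha.le)

lemma norm_le_of_lyapunov_le (hcoer : IsCoercive B) :
    ∃ C > 0, ∀ x y : E, ∀ s ≥ 0, B x x ≤ B y y * s ^ 2 → ‖x‖ ≤ C * s * ‖y‖ := by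
  obtain ⟨a, ha, hlow⟩ := hcoer
  refine ⟨√((‖B‖ + 1) / a), by positivity, fun x y s hs hxy => ?_⟩
  refine le_of_sq_le_sq ?_ (by positivity)
  have hup : B y y ≤ (‖B‖ + 1) * ‖y‖ ^ 2 := by
    rw [sq, ← mul_assoc]
    exact (le_abs_self _).trans ((B.le_opNorm₂ y y).trans (by gcongr; simp))
  rw [mul_pow, mul_pow, Real.sq_sqrt (by positivity), div_mul_eq_mul_div, div_mul_eq_mul_div,
    le_div_iff₀ ha]
  calc ‖x‖ ^ 2 * a = a * ‖x‖ * ‖x‖ := by ring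
    _ ≤ B y y * s ^ 2 := (hlow x).trans hxy
    _ ≤ (‖B‖ + 1) * ‖y‖ ^ 2 * s ^ 2 := by gcongr
    _ = (‖B‖ + 1) * s ^ 2 * ‖y‖ ^ 2 := by ring

lemma lyapunov_decay (hsymm : ∀ x y, B x y = B y x) (hnonneg : ∀ x, 0 ≤ B x x) {c w : ℝ}
    (hc : 0 ≤ c)
    (hdec : ∀ x ≠ zs, B (x - zs) (x - zs) < w → B (x - zs) (g x) < -c * B (x - zs) (x - zs))
    {T : ℝ} {z : ℝ → E} (hz : ∀ t ∈ Set.Icc 0 T, HasDerivWithinAt z (g (z t)) (Set.Icc 0 T) t)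
    (h0 : B (z 0 - zs) (z 0 - zs) < w) {t : ℝ} (ht : t ∈ Set.Icc 0 T) :
    B (z t - zs) (z t - zs) ≤ B (z 0 - zs) (z 0 - zs) * Real.exp (-(2 * c) * t) := by
  have hcont : ContinuousOn (fun s => z s - zs) (Set.Icc 0 T) :=
    fun s hs => (hz s hs).continuousWithinAt.sub continuousWithinAt_const
  have hderiv : ∀ s ∈ Set.Ico 0 T, HasDerivWithinAt (fun s => B (z s - zs) (z s - zs))
      (2 * B (z s - zs) (g (z s))) (Set.Ici s) s := by
    intro s hs
    have hz' : HasDerivWithinAt (fun s => z s - zs) (g (z s)) (Set.Ici s) s :=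
      ((hz s (Set.Ico_subset_Icc_self hs)).mono_of_mem_nhdsWithin
        (Icc_mem_nhdsGE_of_mem hs)).sub_const zs
    refine ((B.hasFDerivAt.comp_hasDerivWithinAt s hz').clm_apply hz').congr_deriv ?_
    rw [hsymm (g (z s)), Function.comp_apply, two_mul]
  refine le_mul_exp_of_deriv_right_lt (by positivity)
    (W := fun s => B (z s - zs) (z s - zs))
    ((B.continuous.comp_continuousOn hcont).clm_apply hcont) hderiv (hnonneg _) h0 ?_ ht
  intro s _ hpos hlt
  have hne : z s ≠ zs := by
    rintro h
    simp [h] at hpos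
  linarith [hdec (z s) hne hlt]

end LyapunovFunctions

section LocalConvergence

variable {E : Type} [NormedAddCommGroup E] [NormedSpace ℝ E]

lemma hasDerivWithinAt_Ici_of_forall_Icc {z v : ℝ → E} {τ : ℝ} (hτ : 0 < τ)
    (hz : ∀ k : ℕ, ∀ t ∈ Set.Icc (k * τ) ((k + 1 : ℕ) * τ),
      HasDerivWithinAt z (v t) (Set.Icc (k * τ) ((k + 1 : ℕ) * τ)) t) (t : ℝ) :
    HasDerivWithinAt z (v t) (Set.Ici 0) t := by
  have hpiece : ∀ k : ℕ, HasDerivWithinAt z (v t) (Set.Icc (k * τ) ((k + 1 : ℕ) * τ)) t := by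
    intro k
    by_cases ht : t ∈ Set.Icc (k * τ) ((k + 1 : ℕ) * τ)
    · exact hz k t ht
    · exact HasFDerivWithinAt.of_notMem_closure (by rwa [isClosed_Icc.closure_eq])
  have hunion : ∀ N : ℕ, HasDerivWithinAt z (v t) (Set.Icc 0 ((N + 1 : ℕ) * τ)) t := by
    intro N
    induction N with
    | zero => simpa using hpiece 0
    | succ N ih =>
      have hN : (N + 1 : ℕ) * τ ≤ (N + 1 + 1 : ℕ) * τ := by gcongr; omega
      rw [← Set.Icc_union_Icc_eq_Icc (by positivity) hN]
      exact ih.union (hpiece (N + 1))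
  obtain ⟨N, hN⟩ := exists_nat_gt (t / τ)
  have htN : t < (N + 1 : ℕ) * τ := by
    push_cast
    linarith [(div_lt_iff₀ hτ).1 hN]
  refine (hunion N).mono_of_mem_nhdsWithin ?_
  rw [← Set.Ici_inter_Iic]
  exact Filter.inter_mem self_mem_nhdsWithin (mem_nhdsWithin_of_mem_nhds (Iic_mem_nhds htN))

lemma exists_isSolution_of_uniform_time {g : E → E} {Ω : Set E} {τ : ℝ} (hτ : 0 < τ)
    (hloc : ∀ x ∈ Ω, ∃ α : ℝ → E, α 0 = x ∧ α τ ∈ Ω ∧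
      ∀ t ∈ Set.Icc 0 τ, HasDerivWithinAt α (g (α t)) (Set.Icc 0 τ) t)
    {x : E} (hx : x ∈ Ω) : ∃ z : ℝ → E, z 0 = x ∧ IsSolution g z := by
  choose! α hα0 hατ hαd using hloc
  let p : ℕ → E := fun k => (fun y => α y τ)^[k] x
  have hp_succ : ∀ k, p (k + 1) = α (p k) τ := fun k => Function.iterate_succ_apply' _ _ _
  have hp : ∀ k, p k ∈ Ω := fun k => by
    induction k with
    | zero => exact hx
    | succ k ih => exact hp_succ k ▸ hατ _ ih
  let z : ℝ → E := fun t => α (p ⌊t / τ⌋₊) (t - ⌊t / τ⌋₊ * τ)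
  have hz : ∀ k : ℕ, ∀ t ∈ Set.Icc (k * τ) ((k + 1 : ℕ) * τ), z t = α (p k) (t - k * τ) := by
    intro k t ht
    rcases eq_or_lt_of_le ht.2 with h | h
    · have hfloor : ⌊t / τ⌋₊ = k + 1 := by
        rw [h, mul_div_cancel_right₀ _ hτ.ne', Nat.floor_natCast]
      have htime : t - k * τ = τ := by
        rw [h]
        push_cast
        ring
      simp only [z, hfloor]
      rw [htime, h, sub_self, hα0 _ (hp _), hp_succ]
    · have hfloor : ⌊t / τ⌋₊ = k :=
        (Nat.floor_eq_iff (div_nonneg ((by positivity : (0 : ℝ) ≤ k * τ).trans ht.1) hτ.le)).2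
          ⟨(le_div_iff₀ hτ).2 ht.1, (div_lt_iff₀ hτ).2 (by exact_mod_cast h)⟩
      simp only [z, hfloor]
  have hderiv : ∀ k : ℕ, ∀ t ∈ Set.Icc (k * τ) ((k + 1 : ℕ) * τ),
      HasDerivWithinAt z (g (z t)) (Set.Icc (k * τ) ((k + 1 : ℕ) * τ)) t := by
    intro k t ht
    have hmaps : Set.MapsTo (fun s : ℝ => s - k * τ) (Set.Icc (k * τ) ((k + 1 : ℕ) * τ))
        (Set.Icc 0 τ) := fun s hs =>
      ⟨sub_nonneg.2 hs.1, sub_le_iff_le_add'.2 (hs.2.trans_eq (by push_cast; ring))⟩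
    have hshift := (hαd _ (hp k) _ (hmaps ht)).scomp t
      ((hasDerivAt_id t).sub_const (k * τ)).hasDerivWithinAt hmaps
    rw [one_smul, ← hz k t ht] at hshift
    exact hshift.congr (hz k) (hz k t ht)
  refine ⟨z, ?_, fun t _ => hasDerivWithinAt_Ici_of_forall_Icc hτ hderiv t⟩
  rw [hz 0 0 (by simp [hτ.le]), Nat.cast_zero, zero_mul, sub_zero]
  exact hα0 x hx

variable {g : E → E} {zs : E} {B : E →L[ℝ] E →L[ℝ] ℝ}

lemma exists_isSolution_of_lyapunov (hsymm : ∀ x y, B x y = B y x) (hnonneg : ∀ x, 0 ≤ B x x)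
    {c w : ℝ} (hc : 0 ≤ c)
    (hdec : ∀ x ≠ zs, B (x - zs) (x - zs) < w → B (x - zs) (g x) < -c * B (x - zs) (x - zs))
    {τ : ℝ} (hτ : 0 < τ)
    (hflow : ∀ x, B (x - zs) (x - zs) < w → ∃ α : ℝ → E, α 0 = x ∧
      ∀ t ∈ Set.Icc 0 τ, HasDerivWithinAt α (g (α t)) (Set.Icc 0 τ) t)
    {x : E} (hx : B (x - zs) (x - zs) < w) : ∃ z : ℝ → E, z 0 = x ∧ IsSolution g z := by
  refine exists_isSolution_of_uniform_time (Ω := {y | B (y - zs) (y - zs) < w}) hτ ?_ hx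
  intro y hy
  obtain ⟨α, rfl, hα⟩ := hflow y hy
  refine ⟨α, rfl, ?_, hα⟩
  have hdecay := lyapunov_decay hsymm hnonneg hc hdec hα hy (Set.right_mem_Icc.2 hτ.le)
  refine (hdecay.trans (mul_le_of_le_one_right (hnonneg _) ?_)).trans_lt hy
  rw [Real.exp_le_one_iff, neg_mul, neg_nonpos]
  positivity

theorem locallyConverges_of_lyapunov [CompleteSpace E] (hg : ContDiffAt ℝ 1 g zs)
    (hsymm : ∀ x y, B x y = B y x) (hcoer : IsCoercive B) {c : ℝ} (hc : 0 < c)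
    (hdec : ∀ᶠ x in 𝓝 zs, x ≠ zs → B (x - zs) (g x) < -c * B (x - zs) (x - zs)) :
    LocallyConverges g zs := by
  have hnonneg : ∀ x, 0 ≤ B x x := fun x => by
    obtain ⟨a, ha, hlow⟩ := hcoer
    exact le_trans (by positivity) (hlow x)
  obtain ⟨r, hr, τ, hτ, hflow⟩ :=
    hg.exists_forall_mem_closedBall_exists_eq_forall_mem_Ioo_hasDerivAt 0
  obtain ⟨w, hw, hsub⟩ :=
    exists_sublevel_subset hcoer (Filter.inter_mem hdec (Metric.closedBall_mem_nhds zs hr))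
  have hdec' : ∀ x ≠ zs, B (x - zs) (x - zs) < w →
      B (x - zs) (g x) < -c * B (x - zs) (x - zs) := fun x hne hx => (hsub hx).1 hne
  have hflow' : ∀ x, B (x - zs) (x - zs) < w → ∃ α : ℝ → E, α 0 = x ∧
      ∀ t ∈ Set.Icc 0 (τ / 2), HasDerivWithinAt α (g (α t)) (Set.Icc 0 (τ / 2)) t := by
    intro x hx
    obtain ⟨α, hα0, hα⟩ := hflow x (hsub hx).2
    refine ⟨α, hα0, fun t ht => (hα t ⟨?_, ?_⟩).hasDerivWithinAt⟩ <;> linarith [ht.1, ht.2]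
  have hsmall : ∀ᶠ x in 𝓝 zs, B (x - zs) (x - zs) < w :=
    (show Continuous fun x => B (x - zs) (x - zs) by fun_prop).continuousAt.eventually_lt
      continuousAt_const (by simpa using hw)
  obtain ⟨δ, hδ, hδw⟩ := Metric.nhds_basis_closedBall.eventually_iff.1 hsmall
  obtain ⟨C, hC, hnorm⟩ := norm_le_of_lyapunov_le hcoer
  refine ⟨δ, hδ, C, hC, c, hc, fun z₀ hz₀ => ?_⟩
  have hz₀w := hδw (mem_closedBall_iff_norm.2 hz₀)
  refine ⟨exists_isSolution_of_lyapunov hsymm hnonneg hc.le hdec' (half_pos hτ) hflow' hz₀w, ?_⟩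
  rintro z rfl hz t ht
  refine hnorm _ _ _ (Real.exp_pos _).le ?_
  rw [← Real.exp_nat_mul, Nat.cast_two, ← mul_assoc, mul_neg]
  exact lyapunov_decay hsymm hnonneg hc.le hdec'
    (fun s hs => (hz s hs.1).mono Set.Icc_subset_Ici_self) hz₀w (Set.right_mem_Icc.2 ht)

theorem IsLyapunovForm.locallyConverges [CompleteSpace E] {A : E →L[ℝ] E} (hB : IsLyapunovForm A B)
    (hg : ContDiffAt ℝ 1 g zs) (hzero : g zs = 0) (hA : HasFDerivAt g A zs) :
    LocallyConverges g zs := by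
  obtain ⟨b, hb, hdec⟩ := hB.decreasing
  have hup : ∀ x y, B x y ≤ (‖B‖ + 1) * ‖x‖ * ‖y‖ := fun x y =>
    (le_abs_self _).trans ((B.le_opNorm₂ x y).trans (by gcongr; simp))
  refine locallyConverges_of_lyapunov hg hB.symm hB.coercive (c := b / (3 * (‖B‖ + 1)))
    (by positivity) ?_
  filter_upwards [hA.isLittleO.def (c := b / (3 * (‖B‖ + 1))) (by positivity)] with x hx hne
  rw [hzero, sub_zero] at hx
  set u := x - zs
  have hu : 0 < ‖u‖ := norm_pos_iff.2 (sub_ne_zero.2 hne)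
  have hremainder : B u (g x - A u) ≤ b / 3 * ‖u‖ ^ 2 := calc
    B u (g x - A u) ≤ (‖B‖ + 1) * ‖u‖ * (b / (3 * (‖B‖ + 1)) * ‖u‖) := (hup _ _).trans (by gcongr)
    _ = b / 3 * ‖u‖ ^ 2 := by field_simp
  have hquad : b / (3 * (‖B‖ + 1)) * B u u ≤ b / 3 * ‖u‖ ^ 2 := calc
    b / (3 * (‖B‖ + 1)) * B u u ≤ b / (3 * (‖B‖ + 1)) * ((‖B‖ + 1) * ‖u‖ * ‖u‖) := by
      gcongr
      exact hup u u
    _ = b / 3 * ‖u‖ ^ 2 := by field_simp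
  have hsplit : B u (g x) = B u (A u) + B u (g x - A u) := by
    rw [← map_add, add_sub_cancel]
  have hpos : 0 < b * ‖u‖ ^ 2 := by positivity
  linarith [hdec u]

end LocalConvergence

section StableOperators

variable {H : Type*} [NormedAddCommGroup H] [InnerProductSpace ℝ H]

/-- The bilinear form `∑_{k < N} ⟪T ^ k x, T ^ k y⟫`, the truncated Stein series, whose quadratic
form decreases under `T` as soon as `‖T ^ N‖ < 1`. -/
def steinForm (T : H →L[ℝ] H) (N : ℕ) : H →L[ℝ] H →L[ℝ] ℝ :=
  ∑ k ∈ Finset.range N, (innerSL ℝ).bilinearComp (T ^ k) (T ^ k)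

lemma steinForm_apply (T : H →L[ℝ] H) (N : ℕ) (x y : H) :
    steinForm T N x y = ∑ k ∈ Finset.range N, inner ℝ ((T ^ k) x) ((T ^ k) y) := by
  simp [steinForm]

lemma steinForm_comm (T : H →L[ℝ] H) (N : ℕ) (x y : H) :
    steinForm T N x y = steinForm T N y x := by
  simp only [steinForm_apply, real_inner_comm]

lemma steinForm_self (T : H →L[ℝ] H) (N : ℕ) (x : H) :
    steinForm T N x x = ∑ k ∈ Finset.range N, ‖(T ^ k) x‖ ^ 2 := by
  simp only [steinForm_apply, real_inner_self_eq_norm_sq]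

lemma steinForm_self_nonneg (T : H →L[ℝ] H) (N : ℕ) (x : H) : 0 ≤ steinForm T N x x := by
  rw [steinForm_self]
  positivity

lemma isCoercive_steinForm (T : H →L[ℝ] H) {N : ℕ} (hN : N ≠ 0) : IsCoercive (steinForm T N) := by
  refine ⟨1, one_pos, fun x => ?_⟩
  rw [one_mul, ← sq, steinForm_self]
  simpa using Finset.single_le_sum (f := fun k => ‖(T ^ k) x‖ ^ 2) (fun k _ => sq_nonneg _)
    (Finset.mem_range.2 hN.bot_lt)

lemma steinForm_map_self_sub (T : H →L[ℝ] H) (N : ℕ) (x : H) :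
    steinForm T N (T x) (T x) - steinForm T N x x = ‖(T ^ N) x‖ ^ 2 - ‖x‖ ^ 2 := by
  have hsucc : ∀ k, (T ^ k) (T x) = (T ^ (k + 1)) x := fun k => by
    rw [pow_succ]
    rfl
  simp only [steinForm_self, hsucc, ← Finset.sum_sub_distrib]
  rw [Finset.sum_range_sub (fun k => ‖(T ^ k) x‖ ^ 2), pow_zero]
  rfl

theorem isLyapunovForm_steinForm (K : H →L[ℝ] H) {ε : ℝ} (hε : 0 < ε) {N : ℕ} (hN : N ≠ 0)
    (hpow : ‖(1 + ε • K) ^ N‖ < 1) : IsLyapunovForm K (steinForm (1 + ε • K) N) := by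
  set T := 1 + ε • K
  have hgap : 0 < 1 - ‖T ^ N‖ ^ 2 := sub_pos.2 (pow_lt_one₀ (norm_nonneg _) hpow two_ne_zero)
  refine ⟨steinForm_comm T N, isCoercive_steinForm T hN,
    (1 - ‖T ^ N‖ ^ 2) / (2 * ε), by positivity, fun x => ?_⟩
  have hexpand : steinForm T N (T x) (T x) = steinForm T N x x
      + 2 * ε * steinForm T N x (K x) + ε ^ 2 * steinForm T N (K x) (K x) := by
    have hTx : T x = x + ε • K x := by simp [T]
    simp only [hTx, map_add, map_smul, add_apply, smul_apply, smul_eq_mul,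
      steinForm_comm T N (K x) x]
    ring
  have hcontract : ‖(T ^ N) x‖ ^ 2 ≤ ‖T ^ N‖ ^ 2 * ‖x‖ ^ 2 := by
    rw [← mul_pow]
    gcongr
    exact (T ^ N).le_opNorm x
  have hsq : 0 ≤ ε ^ 2 * steinForm T N (K x) (K x) :=
    mul_nonneg (sq_nonneg ε) (steinForm_self_nonneg T N _)
  rw [← neg_div, div_mul_eq_mul_div, le_div_iff₀ (by positivity)]
  linarith [steinForm_map_self_sub T N x]

end StableOperators

section Spectrum

open Filter

lemma tendsto_pow_zero_of_spectrum_lt_one {A : Type*} [NormedRing A] [NormedAlgebra ℂ A]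
    [CompleteSpace A] {a : A} (ha : ∀ μ ∈ spectrum ℂ a, ‖μ‖ < 1) :
    Tendsto (fun k : ℕ => a ^ k) atTop (𝓝 0) := by
  cases subsingleton_or_nontrivial A with
  | inl h => exact tendsto_const_nhds.congr fun k => Subsingleton.elim _ _
  | inr h =>
    have hradius : spectralRadius ℂ a < (1 : NNReal) :=
      spectrum.spectralRadius_lt_of_forall_lt a fun μ hμ => ha μ hμ
    obtain ⟨q, hq, hq1⟩ := ENNReal.lt_iff_exists_nnreal_btwn.1 hradius
    refine squeeze_zero_norm' (a := fun k => (q : ℝ) ^ k) ?_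
      (tendsto_pow_atTop_nhds_zero_of_lt_one q.2 (by exact_mod_cast hq1))
    filter_upwards [eventually_gt_atTop 0,
      (spectrum.pow_nnnorm_pow_one_div_tendsto_nhds_spectralRadius a).eventually_lt_const hq]
      with k hk hroot
    rw [one_div, ENNReal.rpow_inv_lt_iff (by positivity), ENNReal.rpow_natCast] at hroot
    exact_mod_cast hroot.le

open Matrix
open scoped ComplexOrder Matrix.Norms.L2Operator

variable {ι : Type} [Fintype ι]

lemma re_star_dotProduct_toComplex_mulVec (M : Matrix ι ι ℝ) (v : ι → ℂ) :
    (star v ⬝ᵥ toComplex M *ᵥ v).re = (Complex.re ∘ v) ⬝ᵥ M *ᵥ (Complex.re ∘ v) +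
      (Complex.im ∘ v) ⬝ᵥ M *ᵥ (Complex.im ∘ v) := by
  simp [dotProduct, mulVec, toComplex, Finset.sum_add_distrib]

variable [DecidableEq ι]

lemma tendsto_pow_zero_of_Sp_lt_one {M : Matrix ι ι ℝ} (hM : ∀ μ ∈ Sp M, ‖μ‖ < 1) :
    Tendsto (fun k : ℕ => M ^ k) atTop (𝓝 0) := by
  have hre : Continuous fun S : Matrix ι ι ℂ => S.map Complex.re :=
    continuous_id.matrix_map Complex.continuous_re
  have hlim := (hre.tendsto 0).comp (tendsto_pow_zero_of_spectrum_lt_one hM)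
  rw [Matrix.map_zero _ Complex.zero_re] at hlim
  refine hlim.congr fun k => ?_
  have hpow : toComplex M ^ k = toComplex (M ^ k) :=
    (map_pow (Complex.ofRealHom.mapMatrix : Matrix ι ι ℝ →+* Matrix ι ι ℂ) M k).symm
  rw [Function.comp_apply, hpow]
  ext i j
  exact Complex.ofReal_re _

lemma exists_forall_norm_one_add_mul_lt_one {S : Set ℂ} (hS : S.Finite) (hre : ∀ μ ∈ S, μ.re < 0) :
    ∃ ε > (0 : ℝ), ∀ μ ∈ S, ‖1 + ε * μ‖ < 1 := by
  have hsmall : ∀ μ ∈ S, ∀ᶠ ε : ℝ in 𝓝[>] 0, ‖1 + (ε : ℂ) * μ‖ < 1 := by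
    intro μ hμ
    have hlim : Tendsto (fun ε : ℝ => 2 * μ.re + ε * Complex.normSq μ) (𝓝[>] 0)
        (𝓝 (2 * μ.re + 0 * Complex.normSq μ)) :=
      (Continuous.tendsto (by fun_prop) 0).mono_left nhdsWithin_le_nhds
    filter_upwards [hlim.eventually_lt_const (u := 0) (by linarith [hre μ hμ]),
      self_mem_nhdsWithin] with ε hneg hε
    have hnormSq : Complex.normSq (1 + ε * μ) = 1 + ε * (2 * μ.re + ε * Complex.normSq μ) := by
      simp only [Complex.normSq_apply, Complex.add_re, Complex.one_re, Complex.mul_re,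
        Complex.ofReal_re, Complex.ofReal_im, zero_mul, sub_zero, Complex.add_im, Complex.one_im,
        Complex.mul_im, add_zero, zero_add]
      ring
    refine lt_of_pow_lt_pow_left₀ 2 zero_le_one ?_
    rw [← Complex.normSq_eq_norm_sq, hnormSq, one_pow, add_lt_iff_neg_left]
    exact mul_neg_of_pos_of_neg hε hneg
  obtain ⟨ε, hlt, hε⟩ := (((eventually_all_finite hS).2 hsmall).and self_mem_nhdsWithin).exists
  exact ⟨ε, hε, hlt⟩

lemma Sp_aeval (M : Matrix ι ι ℝ) (q : Polynomial ℝ) :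
    Sp (Polynomial.aeval M q) = (fun ν => Polynomial.aeval ν q) '' Sp M := by
  have hmap : toComplex (Polynomial.aeval M q) =
      Polynomial.aeval (toComplex M) (q.map (algebraMap ℝ ℂ)) := by
    rw [Polynomial.aeval_map_algebraMap]
    exact (Polynomial.aeval_algHom_apply Complex.ofRealAm.mapMatrix M q).symm
  cases isEmpty_or_nonempty ι with
  | inl h => simp [Sp]
  | inr h =>
  rw [Sp, hmap, spectrum.map_polynomial_aeval_of_nonempty]
  · simp [Sp]
  · exact spectrum.nonempty_of_isAlgClosed_of_finiteDimensional ℂ _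

theorem exists_isLyapunovForm_of_re_neg {M : Matrix ι ι ℝ} (hM : ∀ μ ∈ Sp M, μ.re < 0) :
    ∃ B, IsLyapunovForm (toEuclideanCLM (𝕜 := ℝ) M) B := by
  obtain ⟨ε, hε, hlt⟩ := exists_forall_norm_one_add_mul_lt_one (finite_spectrum _) hM
  have hstable : ∀ μ ∈ Sp (1 + ε • M), ‖μ‖ < 1 := by
    intro μ hμ
    have hpoly : 1 + ε • M = Polynomial.aeval M (1 + Polynomial.C ε * Polynomial.X) := by
      simp [Algebra.smul_def]
    rw [hpoly, Sp_aeval] at hμ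
    obtain ⟨ν, hν, rfl⟩ := hμ
    simpa using hlt ν hν
  have hnorm : Tendsto (fun k : ℕ => ‖(1 + ε • M) ^ k‖) atTop (𝓝 0) :=
    tendsto_zero_iff_norm_tendsto_zero.1 (tendsto_pow_zero_of_Sp_lt_one hstable)
  obtain ⟨N, hpow, hN⟩ := ((hnorm.eventually_lt_const one_pos).and (eventually_ne_atTop 0)).exists
  refine ⟨_, isLyapunovForm_steinForm _ hε hN ?_⟩
  rwa [← map_one (toEuclideanCLM (n := ι) (𝕜 := ℝ)), ← map_smul, ← map_add, ← map_pow,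
    l2_opNorm_toEuclideanCLM]

lemma re_nonpos_of_mem_Sp {M : Matrix ι ι ℝ} (hM : ∀ x : ι → ℝ, x ⬝ᵥ M *ᵥ x ≤ 0) {μ : ℂ}
    (hμ : μ ∈ Sp M) : μ.re ≤ 0 := by
  rw [Sp, ← spectrum_toLin'] at hμ
  obtain ⟨v, hv, hv0⟩ := (Module.End.HasEigenvalue.of_mem_spectrum hμ).exists_hasEigenvector
  rw [Module.End.mem_eigenspace_iff, toLin'_apply] at hv
  have hrayleigh : μ.re * (star v ⬝ᵥ v).re ≤ 0 := by
    have hreal : (star v ⬝ᵥ v).im = 0 :=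
      (Complex.nonneg_iff.1 (dotProduct_star_self_nonneg v)).2.symm
    have hre := re_star_dotProduct_toComplex_mulVec M v
    rw [hv, dotProduct_smul, smul_eq_mul, Complex.mul_re, hreal, mul_zero, sub_zero] at hre
    linarith [hM (Complex.re ∘ v), hM (Complex.im ∘ v)]
  have hpos : 0 < (star v ⬝ᵥ v).re := (Complex.pos_iff.1 (dotProduct_star_self_pos_iff.2 hv0)).1
  exact nonpos_of_mul_nonpos_left hrayleigh hpos

end Spectrum

section SecondOrderCondition

lemma deriv_deriv_nonneg_of_isLocalMin {φ : ℝ → ℝ} {t : ℝ} (hmin : IsLocalMin φ t)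
    (hcont : ContinuousAt φ t) : 0 ≤ deriv (deriv φ) t := by
  by_contra! hneg
  have hmax : IsLocalMax φ t := isLocalMax_of_deriv_deriv_neg hneg hmin.deriv_eq_zero hcont
  have hconst : φ =ᶠ[𝓝 t] fun _ => φ t := by
    filter_upwards [hmin, hmax] with s hge hle using le_antisymm hle hge
  have hzero : deriv (deriv φ) t = 0 := by
    rw [hconst.deriv.deriv_eq]
    simp
  exact hneg.ne hzero

variable {E : Type*} [NormedAddCommGroup E] [NormedSpace ℝ E] {φ : E → ℝ}

lemma fderiv_fderiv_comm (hφ : ContDiff ℝ 2 φ) (p u v : E) :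
    fderiv ℝ (fderiv ℝ φ) p u v = fderiv ℝ (fderiv ℝ φ) p v u :=
  (hφ.contDiffAt.isSymmSndFDerivAt (by simp)).eq u v

lemma deriv_deriv_line (hφ : ContDiff ℝ 2 φ) (p u : E) :
    deriv (deriv fun t : ℝ => φ (p + t • u)) 0 = fderiv ℝ (fderiv ℝ φ) p u u := by
  have hline : ∀ t : ℝ, HasDerivAt (fun t : ℝ => p + t • u) u t := fun t => by
    simpa using ((hasDerivAt_id t).smul_const u).const_add p
  have hderiv : (deriv fun t : ℝ => φ (p + t • u)) = fun t => fderiv ℝ φ (p + t • u) u := by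
    ext t
    exact ((hφ.differentiable two_ne_zero _).hasFDerivAt.comp_hasDerivAt t (hline t)).deriv
  have hfderiv : HasFDerivAt (fun q => fderiv ℝ φ q u) ((fderiv ℝ (fderiv ℝ φ) p).flip u) p :=
    (((hφ.fderiv_right (m := 1) le_rfl).differentiable one_ne_zero p).hasFDerivAt.clm_apply
      (hasFDerivAt_const u p)).congr_fderiv (by simp)
  rw [hderiv]
  exact (hfderiv.comp_hasDerivAt_of_eq 0 (hline 0) (by simp)).deriv

lemma fderiv_fderiv_nonneg_of_isLocalMin (hφ : ContDiff ℝ 2 φ) {p u : E}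
    (hmin : IsLocalMin (fun t : ℝ => φ (p + t • u)) 0) :
    0 ≤ fderiv ℝ (fderiv ℝ φ) p u u := by
  rw [← deriv_deriv_line hφ]
  exact deriv_deriv_nonneg_of_isLocalMin hmin (hφ.continuous.comp (by fun_prop)).continuousAt

lemma fderiv_fderiv_nonpos_of_isLocalMax (hφ : ContDiff ℝ 2 φ) {p u : E}
    (hmax : IsLocalMax (fun t : ℝ => φ (p + t • u)) 0) :
    fderiv ℝ (fderiv ℝ φ) p u u ≤ 0 := by
  have hneg : 0 ≤ deriv (deriv fun t : ℝ => -φ (p + t • u)) 0 :=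
    deriv_deriv_nonneg_of_isLocalMin hmax.neg (hφ.continuous.neg.comp (by fun_prop)).continuousAt
  simpa only [deriv.fun_neg', deriv.fun_neg, Left.nonneg_neg_iff, deriv_deriv_line hφ] using hneg

end SecondOrderCondition

section GradientDescentAscent

variable {n m : ℕ} {f : Euc n × Euc m → ℝ}

/-- The indefinite inner product `⟪z.2, u.2⟫ - ⟪z.1, u.1⟫` on `ℝⁿ × ℝᵐ`, with respect to which
gradient descent-ascent is a gradient flow. -/
def saddleForm (n m : ℕ) : Euc n × Euc m →L[ℝ] Euc n × Euc m →L[ℝ] ℝ :=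
  (innerSL ℝ).bilinearComp (.snd ℝ _ _) (.snd ℝ _ _) -
    (innerSL ℝ).bilinearComp (.fst ℝ _ _) (.fst ℝ _ _)

lemma saddleForm_apply (z u : Euc n × Euc m) :
    saddleForm n m z u = inner ℝ z.2 u.2 - inner ℝ z.1 u.1 := rfl

lemma saddleForm_comm (z u : Euc n × Euc m) : saddleForm n m z u = saddleForm n m u z := by
  simp only [saddleForm_apply, real_inner_comm]

lemma saddleForm_injective : Function.Injective (saddleForm n m) := by
  refine (injective_iff_map_eq_zero _).2 fun z hz => ?_
  have hfst := congr($hz (z.1, 0))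
  have hsnd := congr($hz (0, z.2))
  simp only [saddleForm_apply, inner_zero_right, zero_sub, sub_zero, zero_apply, neg_eq_zero,
    inner_self_eq_zero] at hfst hsnd
  exact Prod.ext hfst hsnd

/-- The vector field `(-∇ₓ f, ∇_y f)` of gradient descent-ascent. -/
def gdaField (f : Euc n × Euc m → ℝ) (p : Euc n × Euc m) : Euc n × Euc m :=
  (-gradX f p, gradY f p)

lemma fderiv_comp_prodMk_left {F : Type*} [NormedAddCommGroup F] [NormedSpace ℝ F]
    {g : Euc n × Euc m → F} {p : Euc n × Euc m} (hg : DifferentiableAt ℝ g p) :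
    fderiv ℝ (fun x => g (x, p.2)) p.1 = (fderiv ℝ g p).comp (.inl ℝ (Euc n) (Euc m)) :=
  (HasFDerivAt.comp p.1 (g := g) (f := fun x => (x, p.2)) hg.hasFDerivAt
    (hasFDerivAt_prodMk_left p.1 p.2)).fderiv

lemma fderiv_comp_prodMk_right {F : Type*} [NormedAddCommGroup F] [NormedSpace ℝ F]
    {g : Euc n × Euc m → F} {p : Euc n × Euc m} (hg : DifferentiableAt ℝ g p) :
    fderiv ℝ (fun y => g (p.1, y)) p.2 = (fderiv ℝ g p).comp (.inr ℝ (Euc n) (Euc m)) :=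
  (HasFDerivAt.comp p.2 (g := g) (f := fun y => (p.1, y)) hg.hasFDerivAt
    (hasFDerivAt_prodMk_right p.1 p.2)).fderiv

lemma gradX_eq {p : Euc n × Euc m} (hf : DifferentiableAt ℝ f p) :
    gradX f p = (InnerProductSpace.toDual ℝ (Euc n)).symm ((fderiv ℝ f p).comp (.inl ℝ _ _)) := by
  rw [gradX, gradient, fderiv_comp_prodMk_left hf]

lemma gradY_eq {p : Euc n × Euc m} (hf : DifferentiableAt ℝ f p) :
    gradY f p = (InnerProductSpace.toDual ℝ (Euc m)).symm ((fderiv ℝ f p).comp (.inr ℝ _ _)) := by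
  rw [gradY, gradient, fderiv_comp_prodMk_right hf]

lemma saddleForm_gdaField {p : Euc n × Euc m} (hf : DifferentiableAt ℝ f p) :
    saddleForm n m (gdaField f p) = fderiv ℝ f p := by
  ext u
  · simp [saddleForm_apply, gdaField, gradX_eq hf]
  · simp [saddleForm_apply, gdaField, gradY_eq hf]

lemma contDiff_gradX {k : WithTop ℕ∞} (hf : ContDiff ℝ (k + 1) f) : ContDiff ℝ k (gradX f) := by
  have h : gradX f = fun p => (InnerProductSpace.toDual ℝ (Euc n)).symm
      ((fderiv ℝ f p).comp (.inl ℝ _ _)) :=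
    funext fun p => gradX_eq (hf.differentiable (by simp) p)
  rw [h]
  exact (InnerProductSpace.toDual ℝ (Euc n)).symm.toContinuousLinearEquiv.contDiff.comp
    ((hf.fderiv_right le_rfl).clm_comp contDiff_const)

lemma contDiff_gradY {k : WithTop ℕ∞} (hf : ContDiff ℝ (k + 1) f) : ContDiff ℝ k (gradY f) := by
  have h : gradY f = fun p => (InnerProductSpace.toDual ℝ (Euc m)).symm
      ((fderiv ℝ f p).comp (.inr ℝ _ _)) :=
    funext fun p => gradY_eq (hf.differentiable (by simp) p)
  rw [h]
  exact (InnerProductSpace.toDual ℝ (Euc m)).symm.toContinuousLinearEquiv.contDiff.comp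
    ((hf.fderiv_right le_rfl).clm_comp contDiff_const)

lemma contDiff_gdaField {k : WithTop ℕ∞} (hf : ContDiff ℝ (k + 1) f) :
    ContDiff ℝ k (gdaField f) :=
  (contDiff_gradX hf).neg.prodMk (contDiff_gradY hf)

lemma saddleForm_fderiv_gdaField (hf : ContDiff ℝ 2 f) (p v u : Euc n × Euc m) :
    saddleForm n m (fderiv ℝ (gdaField f) p v) u = fderiv ℝ (fderiv ℝ f) p v u := by
  have hG : DifferentiableAt ℝ (gdaField f) p :=
    (contDiff_gdaField (k := 1) hf).differentiable one_ne_zero p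
  have h : fderiv ℝ f = fun q => saddleForm n m (gdaField f q) :=
    funext fun q => (saddleForm_gdaField (hf.differentiable two_ne_zero q)).symm
  rw [h]
  exact congr($(((saddleForm n m).hasFDerivAt.comp p hG.hasFDerivAt).fderiv.symm) v u)

lemma saddleForm_fderiv_gdaField_comm (hf : ContDiff ℝ 2 f) (p v u : Euc n × Euc m) :
    saddleForm n m (fderiv ℝ (gdaField f) p v) u =
      saddleForm n m (fderiv ℝ (gdaField f) p u) v := by
  rw [saddleForm_fderiv_gdaField hf, saddleForm_fderiv_gdaField hf, fderiv_fderiv_comm hf]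

lemma modifiedLoss_eq (f : Euc n × Euc m → ℝ) (β h : ℝ) :
    modifiedLoss f β h = fun p => 1 / (1 - β) * f p -
      h * (1 + β) / (4 * (1 - β) ^ 3) * saddleForm n m (gdaField f p) (gdaField f p) := by
  ext p
  simp only [modifiedLoss, saddleForm_apply, gdaField, inner_neg_neg, real_inner_self_eq_norm_sq]
  ring

lemma hasFDerivAt_modifiedLoss (hf : ContDiff ℝ 2 f) (β h : ℝ) (p : Euc n × Euc m) :
    HasFDerivAt (modifiedLoss f β h)
      (saddleForm n m ((1 / (1 - β)) • gdaField f p -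
        (h * (1 + β) / (2 * (1 - β) ^ 3)) • fderiv ℝ (gdaField f) p (gdaField f p))) p := by
  have hG : HasFDerivAt (gdaField f) (fderiv ℝ (gdaField f) p) p :=
    ((contDiff_gdaField (k := 1) hf).differentiable one_ne_zero p).hasFDerivAt
  have hf' : DifferentiableAt ℝ f p := hf.differentiable two_ne_zero p
  have hsq : HasFDerivAt (fun q => saddleForm n m (gdaField f q) (gdaField f q))
      ((2 : ℝ) • saddleForm n m (fderiv ℝ (gdaField f) p (gdaField f p))) p := by
    refine (((saddleForm n m).hasFDerivAt.comp p hG).clm_apply hG).congr_fderiv ?_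
    refine ContinuousLinearMap.ext fun u => ?_
    have hsymm := saddleForm_fderiv_gdaField_comm hf p u (gdaField f p)
    simp [saddleForm_comm (gdaField f p), hsymm, two_mul]
  have hcoef : h * (1 + β) / (4 * (1 - β) ^ 3) * 2 = h * (1 + β) / (2 * (1 - β) ^ 3) := by
    generalize (1 - β) ^ 3 = D
    ring
  rw [modifiedLoss_eq, map_sub, map_smul, map_smul, saddleForm_gdaField hf', ← hcoef, mul_smul]
  exact (hf'.hasFDerivAt.const_mul _).sub (hsq.const_mul _)

theorem simHBField_eq (hf : ContDiff ℝ 2 f) (β h : ℝ) (p : Euc n × Euc m) :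
    simHBField f β h p = (1 / (1 - β)) • gdaField f p -
      (h * (1 + β) / (2 * (1 - β) ^ 3)) • fderiv ℝ (gdaField f) p (gdaField f p) := by
  have hloss := hasFDerivAt_modifiedLoss hf β h p
  have hfield : simHBField f β h p = gdaField (modifiedLoss f β h) p := rfl
  apply saddleForm_injective
  rw [hfield, saddleForm_gdaField hloss.differentiableAt, hloss.fderiv]

lemma contDiff_simHBField (hf : ContDiff ℝ 3 f) (β h : ℝ) : ContDiff ℝ 1 (simHBField f β h) := by
  have hG : ContDiff ℝ 2 (gdaField f) := contDiff_gdaField hf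
  have hfield := funext (simHBField_eq (hf.of_le (by norm_num)) β h)
  rw [hfield]
  exact ((hG.of_le one_le_two).const_smul _).sub
    (((hG.fderiv_right (m := 1) le_rfl).clm_apply (hG.of_le one_le_two)).const_smul _)

lemma simHBField_eq_zero (hf : ContDiff ℝ 2 f) {p : Euc n × Euc m} (hp : gdaField f p = 0)
    (β h : ℝ) : simHBField f β h p = 0 := by
  simp [simHBField_eq hf, hp]

theorem hasFDerivAt_simHBField (hf : ContDiff ℝ 3 f) {p : Euc n × Euc m} (hp : gdaField f p = 0)
    (β h : ℝ) :
    HasFDerivAt (simHBField f β h)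
      ((1 / (1 - β)) • fderiv ℝ (gdaField f) p - (h * (1 + β) / (2 * (1 - β) ^ 3)) •
        (fderiv ℝ (gdaField f) p).comp (fderiv ℝ (gdaField f) p)) p := by
  have hG : ContDiff ℝ 2 (gdaField f) := contDiff_gdaField hf
  have hG1 := (hG.differentiable two_ne_zero p).hasFDerivAt
  have hG2 := ((hG.fderiv_right (m := 1) le_rfl).differentiable one_ne_zero p).hasFDerivAt
  have hfield := funext (simHBField_eq (hf.of_le (by norm_num)) β h)
  rw [hfield]
  refine ((hG1.const_smul (1 / (1 - β))).sub
    ((hG2.clm_apply hG1).const_smul (h * (1 + β) / (2 * (1 - β) ^ 3)))).congr_fderiv ?_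
  simp [hp]

end GradientDescentAscent

section Coordinates

open Matrix EuclideanSpace

variable {n m : ℕ} {f : Euc n × Euc m → ℝ}

lemma jacobianMatrix_mulVec {k l : ℕ} (g : Euc k → Euc l) (x v : Euc k) (i : Fin l) :
    (jacobianMatrix g x *ᵥ v) i = fderiv ℝ g x v i := by
  conv_rhs => rw [← (basisFun (Fin k) ℝ).sum_repr v]
  simp [jacobianMatrix, mulVec, dotProduct, mul_comm]

lemma fderiv_gdaField_apply (hf : ContDiff ℝ 2 f) (p u : Euc n × Euc m) :
    fderiv ℝ (gdaField f) p u = (-fderiv ℝ (gradX f) p u, fderiv ℝ (gradY f) p u) := by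
  have hX := ((contDiff_gradX (k := 1) hf).differentiable one_ne_zero p).hasFDerivAt
  have hY := ((contDiff_gradY (k := 1) hf).differentiable one_ne_zero p).hasFDerivAt
  exact congr($((hX.neg.prodMk hY).fderiv) u)

theorem sumEquivProd_gdaJacobian (hf : ContDiff ℝ 2 f) (p : Euc n × Euc m)
    (x : EuclideanSpace ℝ (Fin n ⊕ Fin m)) :
    sumEquivProd (toEuclideanCLM (𝕜 := ℝ) (gdaJacobian f p) x) =
      fderiv ℝ (gdaField f) p (sumEquivProd x) := by
  have hX := (contDiff_gradX (k := 1) hf).differentiable one_ne_zero p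
  have hY := (contDiff_gradY (k := 1) hf).differentiable one_ne_zero p
  obtain ⟨⟨u, v⟩, rfl⟩ := sumEquivProd.symm.surjective x
  have hsum : (u, v) = ((u, 0) : Euc n × Euc m) + (0, v) := by simp
  have hblocks : gdaJacobian f p *ᵥ Sum.elim u v =
      Sum.elim (-fderiv ℝ (gradX f) p (u, v)) (fderiv ℝ (gradY f) p (u, v)) := by
    rw [gdaJacobian, fromBlocks_mulVec, hsum, map_add, map_add]
    ext (i | i)
    · simp [neg_mulVec, hessXX, hessXY, jacobianMatrix_mulVec, fderiv_comp_prodMk_left hX,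
        fderiv_comp_prodMk_right hX, add_comm]
    · simp [hessYX, hessYY, jacobianMatrix_mulVec, fderiv_comp_prodMk_left hY,
        fderiv_comp_prodMk_right hY]
  rw [ContinuousLinearEquiv.apply_symm_apply, fderiv_gdaField_apply hf]
  ext i
  · exact congr_fun hblocks (.inl i)
  · exact congr_fun hblocks (.inr i)

lemma inner_eq_inner_sumEquivProd (x y : EuclideanSpace ℝ (Fin n ⊕ Fin m)) :
    inner ℝ x y = inner ℝ (sumEquivProd x).1 (sumEquivProd y).1 +
      inner ℝ (sumEquivProd x).2 (sumEquivProd y).2 := by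
  simp [PiLp.inner_apply]

lemma dotProduct_gdaJacobian_mulVec (hf : ContDiff ℝ 2 f) (p : Euc n × Euc m)
    (x : EuclideanSpace ℝ (Fin n ⊕ Fin m)) :
    x.ofLp ⬝ᵥ gdaJacobian f p *ᵥ x.ofLp =
      fderiv ℝ (fderiv ℝ f) p (0, (sumEquivProd x).2) (0, (sumEquivProd x).2) -
        fderiv ℝ (fderiv ℝ f) p ((sumEquivProd x).1, 0) ((sumEquivProd x).1, 0) := by
  rw [← inner_toEuclideanCLM, inner_eq_inner_sumEquivProd, sumEquivProd_gdaJacobian hf]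
  generalize sumEquivProd x = u
  obtain ⟨v, w⟩ := u
  have hsaddle : inner ℝ v (fderiv ℝ (gdaField f) p (v, w)).1 +
      inner ℝ w (fderiv ℝ (gdaField f) p (v, w)).2 =
        fderiv ℝ (fderiv ℝ f) p (v, w) (-v, w) := by
    rw [← saddleForm_fderiv_gdaField hf, saddleForm_apply, inner_neg_right, sub_neg_eq_add,
      add_comm, real_inner_comm v, real_inner_comm w]
  have hsum : ((v, w) : Euc n × Euc m) = (v, 0) + (0, w) := by simp
  have hdiff : ((-v, w) : Euc n × Euc m) = (0, w) - (v, 0) := by simp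
  rw [hsaddle, hdiff, hsum, ContinuousLinearMap.map_add₂, map_sub, map_sub,
    fderiv_fderiv_comm hf p (0, w) (v, 0)]
  simp only [Prod.fst_add, Prod.snd_add, add_zero, zero_add]
  ring

end Coordinates

section LocalNash

open Matrix

variable {n m : ℕ} {f : Euc n × Euc m → ℝ} {xs : Euc n} {ys : Euc m}

lemma IsLocalNash.isLocalMin (hN : IsLocalNash f xs ys) :
    IsLocalMin (fun x => f (x, ys)) xs := by
  obtain ⟨U, hU, _, _, hmin, _⟩ := hN
  exact Filter.mem_of_superset hU hmin

lemma IsLocalNash.isLocalMax (hN : IsLocalNash f xs ys) :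
    IsLocalMax (fun y => f (xs, y)) ys := by
  obtain ⟨_, _, V, hV, _, hmax⟩ := hN
  exact Filter.mem_of_superset hV hmax

lemma IsLocalNash.gradX_eq_zero (hN : IsLocalNash f xs ys) : gradX f (xs, ys) = 0 := by
  rw [gradX, gradient, hN.isLocalMin.fderiv_eq_zero, map_zero]

lemma IsLocalNash.gradY_eq_zero (hN : IsLocalNash f xs ys) : gradY f (xs, ys) = 0 := by
  rw [gradY, gradient, hN.isLocalMax.fderiv_eq_zero, map_zero]

theorem IsLocalNash.dotProduct_gdaJacobian_mulVec_nonpos (hN : IsLocalNash f xs ys)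
    (hf : ContDiff ℝ 2 f) (x : Fin n ⊕ Fin m → ℝ) :
    x ⬝ᵥ gdaJacobian f (xs, ys) *ᵥ x ≤ 0 := by
  have hX : ∀ v, 0 ≤ fderiv ℝ (fderiv ℝ f) (xs, ys) (v, 0) (v, 0) := by
    intro v
    refine fderiv_fderiv_nonneg_of_isLocalMin hf ?_
    have hline := IsLocalMin.comp_continuous (g := fun t : ℝ => xs + t • v) (b := 0)
      (f := fun x => f (x, ys)) (by simpa using hN.isLocalMin) (by fun_prop)
    simpa [Function.comp_def] using hline
  have hY : ∀ w, fderiv ℝ (fderiv ℝ f) (xs, ys) (0, w) (0, w) ≤ 0 := by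
    intro w
    refine fderiv_fderiv_nonpos_of_isLocalMax hf ?_
    have hline := IsLocalMax.comp_continuous (g := fun t : ℝ => ys + t • w) (b := 0)
      (f := fun y => f (xs, y)) (by simpa using hN.isLocalMax) (by fun_prop)
    simpa [Function.comp_def] using hline
  exact (dotProduct_gdaJacobian_mulVec hf _ (WithLp.toLp 2 x)).trans_le
    (sub_nonpos.2 ((hY _).trans (hX _)))

lemma IsLocalNash.re_nonpos (hN : IsLocalNash f xs ys) (hf : ContDiff ℝ 2 f) {μ : ℂ}
    (hμ : μ ∈ Sp (gdaJacobian f (xs, ys))) : μ.re ≤ 0 :=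
  re_nonpos_of_mem_Sp (hN.dotProduct_gdaJacobian_mulVec_nonpos hf) hμ

end LocalNash

section SimHB

open Matrix EuclideanSpace Polynomial

variable {n m : ℕ} {f : Euc n × Euc m → ℝ} {p : Euc n × Euc m} {β h : ℝ}

/-- The matrix `𝒥 / (1 - β) - h (1 + β) / (2 (1 - β)³) 𝒥²`, which is the Jacobian of the
Continuous Sim-HB field at a critical point of `f`. -/
def simHBJacobian (f : Euc n × Euc m → ℝ) (β h : ℝ) (p : Euc n × Euc m) :
    Matrix (Fin n ⊕ Fin m) (Fin n ⊕ Fin m) ℝ :=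
  (1 / (1 - β)) • gdaJacobian f p -
    (h * (1 + β) / (2 * (1 - β) ^ 3)) • (gdaJacobian f p * gdaJacobian f p)

lemma Sp_simHBJacobian (f : Euc n × Euc m → ℝ) (β h : ℝ) (p : Euc n × Euc m) :
    Sp (simHBJacobian f β h p) =
      (fun μ : ℂ => (1 / (1 - β) : ℝ) * μ - (h * (1 + β) / (2 * (1 - β) ^ 3) : ℝ) * (μ * μ)) ''
        Sp (gdaJacobian f p) := by
  have hpoly : simHBJacobian f β h p = aeval (gdaJacobian f p)
      (C (1 / (1 - β)) * X - C (h * (1 + β) / (2 * (1 - β) ^ 3)) * (X * X)) := by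
    simp only [simHBJacobian, map_sub, map_mul, aeval_C, aeval_X, Algebra.smul_def]
  rw [hpoly, Sp_aeval]
  simp only [map_sub, map_mul, aeval_C, aeval_X, Complex.coe_algebraMap]

lemma re_neg_of_mem_Sp_simHBJacobian (hβ : β < 1)
    (hspec : ∀ μ ∈ Sp (gdaJacobian f p),
      h * (1 + β) * (μ.im ^ 2 - μ.re ^ 2) < 2 * (1 - β) ^ 2 * -μ.re) :
    ∀ μ ∈ Sp (simHBJacobian f β h p), μ.re < 0 := by
  rw [Sp_simHBJacobian, Set.forall_mem_image]
  intro μ hμ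
  have hβ' : 0 < 1 - β := sub_pos.2 hβ
  have hre : 1 / (1 - β) * μ.re - h * (1 + β) / (2 * (1 - β) ^ 3) * (μ.re * μ.re - μ.im * μ.im) =
      (h * (1 + β) * (μ.im ^ 2 - μ.re ^ 2) - 2 * (1 - β) ^ 2 * -μ.re) / (2 * (1 - β) ^ 3) := by
    field_simp
    ring
  rw [Complex.sub_re, Complex.re_ofReal_mul, Complex.re_ofReal_mul, Complex.mul_re, hre]
  exact div_neg_of_neg_of_pos (sub_neg.2 (hspec μ hμ)) (by positivity)

lemma sumEquivProd_simHBJacobian (hf : ContDiff ℝ 2 f) (β h : ℝ) (p : Euc n × Euc m)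
    (x : EuclideanSpace ℝ (Fin n ⊕ Fin m)) :
    sumEquivProd (toEuclideanCLM (𝕜 := ℝ) (simHBJacobian f β h p) x) =
      ((1 / (1 - β)) • fderiv ℝ (gdaField f) p - (h * (1 + β) / (2 * (1 - β) ^ 3)) •
        (fderiv ℝ (gdaField f) p).comp (fderiv ℝ (gdaField f) p)) (sumEquivProd x) := by
  simp only [simHBJacobian, map_sub, map_smul, map_mul, _root_.sub_apply, _root_.smul_apply,
    mul_apply_eq_comp, ContinuousLinearMap.comp_apply, sumEquivProd_gdaJacobian hf]

theorem locallyConverges_simHBField (hf : ContDiff ℝ 3 f) (hp : gdaField f p = 0)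
    (hspec : ∀ μ ∈ Sp (simHBJacobian f β h p), μ.re < 0) :
    LocallyConverges (simHBField f β h) p := by
  have hf₂ : ContDiff ℝ 2 f := hf.of_le (by norm_num)
  obtain ⟨B, hB⟩ := exists_isLyapunovForm_of_re_neg hspec
  refine (hB.conj sumEquivProd.symm fun u => ?_).locallyConverges
    (contDiff_simHBField hf β h).contDiffAt (simHBField_eq_zero hf₂ hp β h)
    (hasFDerivAt_simHBField hf hp β h)
  rw [ContinuousLinearEquiv.symm_apply_eq, sumEquivProd_simHBJacobian hf₂,
    ContinuousLinearEquiv.apply_symm_apply]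

lemma step_lt_of_dominant (hβ : -1 < β) {μ : ℂ} (hre : μ.re ≤ 0) (hdom : |μ.re| < |μ.im|)
    (hstep : h < 2 * (1 - β) ^ 2 / (1 + β) * (|μ.re| / (μ.im ^ 2 - μ.re ^ 2))) :
    h * (1 + β) * (μ.im ^ 2 - μ.re ^ 2) < 2 * (1 - β) ^ 2 * -μ.re := by
  have hβ' : 0 < 1 + β := by linarith
  have hgap : 0 < μ.im ^ 2 - μ.re ^ 2 := sub_pos.2 (sq_lt_sq.2 hdom)
  rwa [abs_of_nonpos hre, div_mul_div_comm, lt_div_iff₀ (by positivity), ← mul_assoc] at hstep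

end SimHB

end MinMaxGame

end

theorem theorem4p6_general {n m : ℕ} {f : MinMaxGame.Euc n × MinMaxGame.Euc m → ℝ}
    (hf : ContDiff ℝ 3 f) {p : MinMaxGame.Euc n × MinMaxGame.Euc m}
    (hX : MinMaxGame.gradX f p = 0) (hY : MinMaxGame.gradY f p = 0)
    {β h : ℝ} (hβ : β < 1)
    (hspec : ∀ μ ∈ MinMaxGame.Sp (MinMaxGame.gdaJacobian f p),
      h * (1 + β) * (μ.im ^ 2 - μ.re ^ 2) < 2 * (1 - β) ^ 2 * -μ.re) :
    MinMaxGame.LocallyConverges (MinMaxGame.simHBField f β h) p :=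
  MinMaxGame.locallyConverges_simHBField hf (by simp [MinMaxGame.gdaField, hX, hY])
    (MinMaxGame.re_neg_of_mem_Sp_simHBJacobian hβ hspec)

theorem theorem4p6 {n m : ℕ}
    (f : MinMaxGame.Euc n × MinMaxGame.Euc m → ℝ) (hf : ContDiff ℝ ∞ f)
    (xs : MinMaxGame.Euc n) (ys : MinMaxGame.Euc m)
    (hNash : MinMaxGame.IsLocalNash f xs ys)
    (hInteraction : MinMaxGame.DominantInteraction f (xs, ys))
    (hEigVec : MinMaxGame.EigVecKerTrivial f (xs, ys))
    (β h : ℝ) (hβ : β ∈ Set.Ioo (-1 : ℝ) 1) (hpos : 0 < h)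
    (hstep : ∀ μ ∈ MinMaxGame.Sp (MinMaxGame.gdaJacobian f (xs, ys)),
      h < 2 * (1 - β) ^ 2 / (1 + β) * (|μ.re| / (μ.im ^ 2 - μ.re ^ 2))) :
    MinMaxGame.LocallyConverges (MinMaxGame.simHBField f β h) (xs, ys) := by
  have hf₂ : ContDiff ℝ 2 f := contDiff_infty.1 hf 2
  have hf₃ : ContDiff ℝ 3 f := contDiff_infty.1 hf 3
  exact theorem4p6_general hf₃ hNash.gradX_eq_zero hNash.gradY_eq_zero hβ.2 fun μ hμ =>
    MinMaxGame.step_lt_of_dominant hβ.1 (hNash.re_nonpos hf₂ hμ) (hInteraction μ hμ) (hstep μ hμ)
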